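/- Let $(\mathbb X,d,\mu)$ be a space of homogeneous type: $d$ is a quasi-metric on $\mathbb X$, i.e. $d\ge 0$, $d(x,y)=0$ iff $x=y$, $d(x,y)=d(y,x)$ and $d(x,y)\le\kappa\,(d(x,z)+d(z,y))$ for all $x,y,z$, with a constant $\kappa\ge 1$; and $\mu$ is a Borel regular measure (with respect to the topology of $d$) for which the balls $B(x,r)=\{y: d(y,x)<r\}$, $r>0$, are measurable, with $0<\mu(B(x,r))<\infty$ and $\mu(B(x,2r))\le c_\mu\,\mu(B(x,r))$ for all $x\in\mathbb X$, $r>0$. Let $\varphi:[0,\infty)\to[0,\infty)$ be increasing, concave and continuous, with $\varphi(0)=0$ and $\lim_{t\to\infty}\varphi(t)=+\infty$. For measurable $f:\mathbb X\to\mathbb R$ put $$\|f\|_{\mathrm{BMO}(\mathbb X)}=\sup_B\inf_{c\in\mathbb R}\frac1{\mu(B)}\int_B|f-c|\,d\mu,$$ $$\|f\|_{\mathrm{BMO}_\varphi(\mathbb X)}=\sup_B\inf_{c\in\mathbb R}\inf\Big\{\lambda>0:\ \frac1{\mu(B)}\int_B\varphi\Big(\frac{|f-c|}{\lambda}\Big)d\mu\le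 1\Big\},$$ where the suprema are over all balls $B\subset\mathbb X$ and $\inf\emptyset=\infty$, and let $\mathrm{BMO}(\mathbb X)$ and $\mathrm{BMO}_\varphi(\mathbb X)$ be the classes of measurable functions for which the respective quantity is finite. Then $\mathrm{BMO}(\mathbb X)=\mathrm{BMO}_\varphi(\mathbb X)$, and for every measurable $f$ $$\varphi^{-1}(1)\,\|f\|_{\mathrm{BMO}_\varphi(\mathbb X)}\le\|f\|_{\mathrm{BMO}(\mathbb X)}\le c_{\varphi,\mu}\,\|f\|_{\mathrm{BMO}_\varphi(\mathbb X)},$$ where $c_{\varphi,\mu}<\infty$ depends only on $\varphi$, the quasi-metric constant $\kappa$ and the doubling constant $c_\mu$. -/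

import Mathlib

open MeasureTheory Set Filter
open scoped NNReal ENNReal

namespace HomogeneousType

/-- `d` is a quasi-metric on `X` with constant `κ ≥ 1` in the quasi-triangle inequality. -/
structure IsQuasiMetric {X : Type*} (d : X → X → ℝ) (κ : ℝ) : Prop where
  one_le : 1 ≤ κ
  nonneg : ∀ x y, 0 ≤ d x y
  eq_zero_iff : ∀ x y, d x y = 0 ↔ x = y
  symm : ∀ x y, d x y = d y x
  triangle : ∀ x y z, d x y ≤ κ * (d x z + d z y)

/-- The ball `{y : d(y, x) < r}` of centre `x` and radius `r`. -/
def qball {X : Type*} (d : X → X → ℝ) (x : X) (r : ℝ) : Set X := {y | d y x < r}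

/-- The topology of a quasi-metric: a set is open when it contains a ball around each of its
points. (The balls of a quasi-metric need not be open themselves.) -/
abbrev quasiTopology {X : Type*} (d : X → X → ℝ) : TopologicalSpace X where
  IsOpen U := ∀ x ∈ U, ∃ r : ℝ, 0 < r ∧ qball d x r ⊆ U
  isOpen_univ := fun _ _ => ⟨1, one_pos, subset_univ _⟩
  isOpen_inter := by
    rintro U V hU hV x ⟨hxU, hxV⟩
    obtain ⟨r, hr, hrU⟩ := hU x hxU
    obtain ⟨s, hs, hsV⟩ := hV x hxV
    refine ⟨min r s, lt_min hr hs, fun y hy => ⟨hrU ?_, hsV ?_⟩⟩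
    · exact lt_of_lt_of_le hy (min_le_left r s)
    · exact lt_of_lt_of_le hy (min_le_right r s)
  isOpen_sUnion := by
    rintro S hS x ⟨U, hU, hxU⟩
    obtain ⟨r, hr, hrU⟩ := hS U hU x hxU
    exact ⟨r, hr, hrU.trans (subset_sUnion_of_mem hU)⟩

/-- The Borel σ-algebra of the quasi-metric topology. -/
abbrev quasiBorel {X : Type*} (d : X → X → ℝ) : MeasurableSpace X :=
  @borel X (quasiTopology d)

/-- `(X, d, μ)` is a space of homogeneous type with quasi-metric constant `κ` and doubling
constant `C`. The measure is defined on a σ-algebra that contains the balls and the Borel sets, it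
is Borel regular (the σ-algebra may be the Borel one or, for instance, its completion), and balls
have positive and finite measure. -/
structure IsHomogeneousType {X : Type*} [MeasurableSpace X] (d : X → X → ℝ) (μ : Measure X)
    (κ : ℝ) (C : ℝ≥0) : Prop where
  quasiMetric : IsQuasiMetric d κ
  borel_le : ∀ A : Set X, MeasurableSet[quasiBorel d] A → MeasurableSet A
  measurableSet_ball : ∀ (x : X) (r : ℝ), 0 < r → MeasurableSet (qball d x r)
  borel_regular : ∀ A : Set X, MeasurableSet A →
    ∃ A' : Set X, A ⊆ A' ∧ MeasurableSet[quasiBorel d] A' ∧ μ A' = μ A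
  ball_pos : ∀ (x : X) (r : ℝ), 0 < r → 0 < μ (qball d x r)
  ball_lt_top : ∀ (x : X) (r : ℝ), 0 < r → μ (qball d x r) < ∞
  doubling : ∀ (x : X) (r : ℝ), 0 < r → μ (qball d x (2 * r)) ≤ C * μ (qball d x r)

/-- The Luxemburg expression
`inf {lam > 0 : (1 / μ(B)) ∫_B φ(|g| / lam) dμ ≤ 1}`, with value `∞` if there is no such `lam`. -/
noncomputable def luxemburg {X : Type*} [MeasurableSpace X] (φ : ℝ≥0 → ℝ≥0) (μ : Measure X)
    (B : Set X) (g : X → ℝ) : ℝ≥0∞ :=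
  ⨅ (lam : ℝ≥0) (_ : 0 < lam) (_ : ⨍⁻ x in B, (φ (‖g x‖₊ / lam) : ℝ≥0∞) ∂μ ≤ 1), (lam : ℝ≥0∞)

/-- `‖f‖_{BMO_φ(X)} = sup_B inf_c ‖f - c‖_{φ,B}`, the supremum over all balls. -/
noncomputable def bmoPhiNorm {X : Type*} [MeasurableSpace X] (φ : ℝ≥0 → ℝ≥0) (d : X → X → ℝ)
    (μ : Measure X) (f : X → ℝ) : ℝ≥0∞ :=
  ⨆ (x : X) (r : ℝ) (_ : 0 < r), ⨅ c : ℝ, luxemburg φ μ (qball d x r) (fun y => f y - c)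

/-- `‖f‖_{BMO(X)} = sup_B inf_c (1 / μ(B)) ∫_B |f - c| dμ`, the supremum over all balls. -/
noncomputable def bmoNorm {X : Type*} [MeasurableSpace X] (d : X → X → ℝ)
    (μ : Measure X) (f : X → ℝ) : ℝ≥0∞ :=
  ⨆ (x : X) (r : ℝ) (_ : 0 < r), ⨅ c : ℝ, ⨍⁻ y in qball d x r, (‖f y - c‖₊ : ℝ≥0∞) ∂μ

/-- The class `BMO_φ(X)`. -/
def BMOPhi {X : Type*} [MeasurableSpace X] (φ : ℝ≥0 → ℝ≥0) (d : X → X → ℝ)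
    (μ : Measure X) : Set (X → ℝ) :=
  {f | Measurable f ∧ bmoPhiNorm φ d μ f < ∞}

/-- The class `BMO(X)`. -/
def BMO {X : Type*} [MeasurableSpace X] (d : X → X → ℝ) (μ : Measure X) : Set (X → ℝ) :=
  {f | Measurable f ∧ bmoNorm d μ f < ∞}

end HomogeneousType

/-!
The lower estimate is Jensen's inequality. With `a = φ⁻¹(1)`, a supporting line `t ↦ b + k t` of `φ`
at `a` satisfies `b + k a = 1`, and integrating it shows that the mean of `φ(|f - c| / lam)` is at
most `1` as soon as `a * lam` exceeds the mean of `|f - c|` (`mul_luxemburg_le_laverage`).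

The upper estimate is a John–Strömberg argument. By Chebyshev's inequality and `φ(t) → ∞`, a bound
on `‖f‖_{BMO_φ}` provides for every ball `B` a constant `c_B` such that `|f - c_B| ≤ L` on `B`
outside a set of measure at most `s μ(B)`, where `s` may be prescribed and `L` is a multiple of the
norm (`measure_lt_of_luxemburg_lt`). If `s` is small compared with the doubling constant, the
constants of nested comparable balls differ by at most `2L`. Given a ball `B₀`, one selects around
the points of `B₀` the largest dyadic balls whose constants are more than `4L` away from `c_{B₀}`.
The union of these balls has small measure, since `|f - c_{B₀}| > 3L` on most of each of them, and
almost everywhere outside of it `|f - c_{B₀}| ≤ 5L`. A Vitali covering then shows that raising the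
level by `6L` halves the relative measure of the level sets of `|f - c_B|`, uniformly in `B`
(`IsHomogeneousType.measure_level_add_le`), and summing up gives mean oscillation at most `12L`.

The almost everywhere statement needs only a weak density theorem
(`IsHomogeneousType.measure_eq_zero_of_small_density`). It follows from a Vitali covering and outer
regularity, and the latter holds because the topology of a quasi-metric is pseudometrizable.
-/

namespace HomogeneousType

open scoped Topology

/-! ### The topology of a quasi-metric -/

section Topology

variable {X : Type*} {d : X → X → ℝ} {κ : ℝ}

theorem IsQuasiMetric.self_eq_zero (h : IsQuasiMetric d κ) (x : X) : d x x = 0 :=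
  (h.eq_zero_iff x x).2 rfl

theorem IsQuasiMetric.pos (h : IsQuasiMetric d κ) : 0 < κ := one_pos.trans_le h.one_le

theorem IsQuasiMetric.mem_qball_self (h : IsQuasiMetric d κ) (x : X) {r : ℝ} (hr : 0 < r) :
    x ∈ qball d x r := by
  simpa [qball, h.self_eq_zero] using hr

theorem qball_mono (x : X) {r s : ℝ} (hrs : r ≤ s) : qball d x r ⊆ qball d x s :=
  fun _ hy => lt_of_lt_of_le hy hrs

theorem IsQuasiMetric.qball_subset (h : IsQuasiMetric d κ) {x y : X} {r s t : ℝ}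
    (hy : y ∈ qball d x s) (hst : κ * (r + s) ≤ t) : qball d y r ⊆ qball d x t := by
  intro z hz
  have h1 : d z y < r := hz
  have h2 : d y x < s := hy
  have h3 := h.triangle z x y
  have h4 : κ * (d z y + d y x) < κ * (r + s) := by
    have := h.pos
    gcongr
  exact lt_of_le_of_lt h3 (h4.trans_le hst)

/-- The uniform structure of a quasi-metric, generated by the sets `{(x, y) : d(x, y) < r}`. -/
abbrev IsQuasiMetric.uniformSpace (h : IsQuasiMetric d κ) : UniformSpace X :=
  UniformSpace.ofCore
    { uniformity := comap (fun p : X × X => d p.1 p.2) (nhds 0)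
      refl := by
        intro s hs
        obtain ⟨t, ht, hts⟩ := mem_comap.1 hs
        rw [mem_principal]
        rintro ⟨x, y⟩ hxy
        obtain rfl : x = y := hxy
        apply hts
        simpa [h.self_eq_zero] using mem_of_mem_nhds ht
      symm := by
        rw [tendsto_comap_iff]
        have : (fun p : X × X => d p.1 p.2) ∘ Prod.swap = fun p : X × X => d p.1 p.2 :=
          funext fun p => h.symm _ _
        rw [this]
        exact tendsto_comap
      comp := by
        intro s hs
        obtain ⟨t, ht, hts⟩ := mem_comap.1 hs
        obtain ⟨ε, hε, hεt⟩ := Metric.mem_nhds_iff.1 ht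
        have hκ := h.pos
        rw [mem_lift'_sets fun _ _ hab => SetRel.comp_subset_comp hab hab]
        refine ⟨_, preimage_mem_comap (Metric.ball_mem_nhds 0
          (show 0 < ε / (2 * κ) by positivity)), ?_⟩
        rintro ⟨x, y⟩ ⟨z, hxz, hzy⟩
        apply hts
        apply hεt
        have h1 : d x z < ε / (2 * κ) := by
          simpa [abs_of_nonneg (h.nonneg x z)] using hxz
        have h2 : d z y < ε / (2 * κ) := by
          simpa [abs_of_nonneg (h.nonneg z y)] using hzy
        have h3 : d x y < ε := calc
          d x y ≤ κ * (d x z + d z y) := h.triangle x y z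
          _ < κ * (ε / (2 * κ) + ε / (2 * κ)) := by gcongr
          _ = ε := by field_simp; norm_num
        simpa [abs_of_nonneg (h.nonneg x y)] using h3 }

theorem IsQuasiMetric.uniformSpace_toTopologicalSpace (h : IsQuasiMetric d κ) :
    h.uniformSpace.toTopologicalSpace = quasiTopology d := by
  refine TopologicalSpace.ext_iff.2 fun U => ?_
  let := h.uniformSpace
  rw [isOpen_uniformity]
  refine forall₂_congr fun x _ => ?_
  change _ ∈ comap (fun p : X × X => d p.1 p.2) (nhds 0) ↔ _
  rw [(Metric.nhds_basis_ball.comap _).mem_iff]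
  refine exists_congr fun r => and_congr_right fun _ => ⟨fun H y hy => ?_, ?_⟩
  · refine H (a := (x, y)) ?_ rfl
    have : d x y < r := (h.symm x y).trans_lt hy
    simpa [abs_of_nonneg (h.nonneg x y)] using this
  · rintro H ⟨x', y⟩ hxy rfl
    refine H ?_
    change d y x' < r
    rw [h.symm]
    simpa [abs_of_nonneg (h.nonneg x' y)] using hxy

/-- The topology of a quasi-metric is pseudometrizable, its uniformity being countably
generated. -/
theorem IsQuasiMetric.pseudoMetrizableSpace (h : IsQuasiMetric d κ) :
    @TopologicalSpace.PseudoMetrizableSpace X (quasiTopology d) := by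
  rw [← h.uniformSpace_toTopologicalSpace]
  let := h.uniformSpace
  have : (uniformity X).IsCountablyGenerated :=
    inferInstanceAs (comap (fun p : X × X => d p.1 p.2) (nhds 0)).IsCountablyGenerated
  infer_instance

/-- Balls of a quasi-metric need not be open, but each contains an open set which contains the
concentric ball of radius smaller by a fixed factor. -/
theorem IsQuasiMetric.exists_isOpen_between (h : IsQuasiMetric d κ) (x : X) {r : ℝ} (hr : 0 < r) :
    ∃ W, IsOpen[quasiTopology d] W ∧ qball d x r ⊆ W ∧ W ⊆ qball d x (2 * κ * r) := by
  let := quasiTopology d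
  refine ⟨interior (qball d x (2 * κ * r)), isOpen_interior, fun y hy => ?_, interior_subset⟩
  rw [mem_interior_iff_mem_nhds]
  let := h.uniformSpace
  have hn : @nhds X (quasiTopology d) y = comap (Prod.mk y) (uniformity X) := by
    rw [← h.uniformSpace_toTopologicalSpace]
    exact nhds_eq_comap_uniformity
  rw [hn]
  refine ⟨{p | d p.1 p.2 < r}, preimage_mem_comap (Iio_mem_nhds hr), fun z hz => ?_⟩
  refine h.qball_subset hy (r := r) (by linarith) ?_
  have hz' : d y z < r := hz
  change d z y < r
  rwa [h.symm]

end Topology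

/-! ### Outer regularity, covering and density -/

/-- Outer regularity inside an open set `W` of finite measure, for a measure whose σ-algebra may be
larger than the Borel one. -/
theorem exists_isOpen_measure_lt {X : Type*} [TopologicalSpace X]
    [TopologicalSpace.PseudoMetrizableSpace X] {m : MeasurableSpace X} (hm : borel X ≤ m)
    (μ : Measure X) {A W : Set X} (hA : MeasurableSet[borel X] A) (hW : IsOpen W) (hAW : A ⊆ W)
    (hμW : μ W ≠ ∞) {b : ℝ≥0∞} (hb : μ A < b) :
    ∃ U, A ⊆ U ∧ U ⊆ W ∧ IsOpen U ∧ μ U < b := by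
  have hopen : ∀ U : Set X, IsOpen U → MeasurableSet[borel X] U := fun U hU =>
    MeasurableSpace.measurableSet_generateFrom hU
  let ν : @Measure X (borel X) := (μ.restrict W).trim hm
  have hν : ∀ S, MeasurableSet[borel X] S → ν S = μ (S ∩ W) := fun S hS => by
    rw [trim_measurableSet_eq hm hS, Measure.restrict_apply (hm S hS)]
  let := borel X
  have : BorelSpace X := ⟨rfl⟩
  have : IsFiniteMeasure ν := ⟨by
    rw [hν univ MeasurableSet.univ, univ_inter]
    exact hμW.lt_top⟩
  obtain ⟨U, hAU, hU, hUb⟩ := A.exists_isOpen_lt_of_lt (μ := ν) b (by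
    rw [hν A hA, inter_eq_left.2 hAW]
    exact hb)
  refine ⟨U ∩ W, subset_inter hAU hAW, inter_subset_right, hU.inter hW, ?_⟩
  rwa [hν U (hopen U hU)] at hUb

section Covering

variable {X : Type*} [MeasurableSpace X] {d : X → X → ℝ} {μ : Measure X} {κ : ℝ} {C : ℝ≥0}

theorem IsHomogeneousType.measure_qball_le (h : IsHomogeneousType d μ κ C) (n : ℕ) (x : X)
    {r t : ℝ} (hr : 0 < r) (ht : t ≤ 2 ^ n * r) :
    μ (qball d x t) ≤ (C : ℝ≥0∞) ^ n * μ (qball d x r) := by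
  induction n generalizing r t with
  | zero => simpa using measure_mono (qball_mono x (by simpa using ht))
  | succ n ih =>
    calc μ (qball d x t) ≤ (C : ℝ≥0∞) ^ n * μ (qball d x (2 * r)) :=
          ih (by positivity) (ht.trans_eq (by ring))
      _ ≤ (C : ℝ≥0∞) ^ n * (C * μ (qball d x r)) := by gcongr; exact h.doubling x r hr
      _ = _ := by ring

/-- Outer regularity for arbitrary sets inside an open set of finite measure. -/
theorem IsHomogeneousType.exists_isOpen_measure_lt (h : IsHomogeneousType d μ κ C)
    {A W : Set X} (hW : IsOpen[quasiTopology d] W) (hAW : A ⊆ W) (hμW : μ W ≠ ∞)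
    {b : ℝ≥0∞} (hb : μ A < b) :
    ∃ U, A ⊆ U ∧ U ⊆ W ∧ IsOpen[quasiTopology d] U ∧ μ U < b := by
  obtain ⟨A', hA', hA'm, hA'μ⟩ := h.borel_regular _ (measurableSet_toMeasurable μ A)
  rw [measure_toMeasurable] at hA'μ
  let := quasiTopology d
  have := h.quasiMetric.pseudoMetrizableSpace
  have hWm : MeasurableSet[quasiBorel d] W := MeasurableSpace.measurableSet_generateFrom hW
  obtain ⟨U, hU⟩ := HomogeneousType.exists_isOpen_measure_lt h.borel_le μ (A := A' ∩ W)
    (hA'm.inter hWm) hW inter_subset_right hμW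
    ((measure_mono inter_subset_left).trans_lt (hA'μ.trans_lt hb))
  exact ⟨U, (subset_inter ((subset_toMeasurable μ A).trans hA') hAW).trans hU.1, hU.2⟩

/-- Vitali covering: from balls of bounded radius contained in a set of finite measure one can
select countably many disjoint ones, whose dilates by the factor `3κ` cover all the centres. -/
theorem IsHomogeneousType.exists_disjoint_covering (h : IsHomogeneousType d μ κ C)
    {A W : Set X} {r : X → ℝ} {R : ℝ} (hr : ∀ x ∈ A, 0 < r x) (hR : ∀ x ∈ A, r x ≤ R)
    (hW : ∀ x ∈ A, qball d x (r x) ⊆ W) (hμW : μ W ≠ ∞) :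
    ∃ u ⊆ A, u.Countable ∧ u.PairwiseDisjoint (fun x => qball d x (r x)) ∧
      A ⊆ ⋃ x ∈ u, qball d x (3 * κ * r x) := by
  have hq := h.quasiMetric
  obtain ⟨u, huA, hdisj, hcov⟩ := Vitali.exists_disjoint_subfamily_covering_enlargement
    (fun x => qball d x (r x)) A r 2 one_lt_two (fun x hx => (hr x hx).le) R hR
    fun x hx => ⟨x, hq.mem_qball_self x (hr x hx)⟩
  refine ⟨u, huA, ?_, hdisj, fun x hx => ?_⟩
  · have hc := Measure.countable_meas_pos_of_disjoint_of_meas_iUnion_ne_top μ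
      (As := fun x : u => qball d (x : X) (r x))
      (fun x => h.measurableSet_ball x _ (hr x (huA x.2)))
      (fun x y hxy => hdisj x.2 y.2 (Subtype.coe_injective.ne hxy))
      (ne_top_of_le_ne_top hμW (measure_mono (iUnion_subset fun x => hW x (huA x.2))))
    have huniv : {x : u | 0 < μ (qball d (x : X) (r x))} = univ :=
      eq_univ_of_forall fun x => h.ball_pos x _ (hr x (huA x.2))
    rw [huniv] at hc
    exact countable_coe_iff.1 (countable_univ_iff.1 hc)
  · obtain ⟨y, hyu, ⟨z, hzx, hzy⟩, hxy⟩ := hcov x hx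
    refine mem_iUnion₂.2 ⟨y, hyu, ?_⟩
    have h1 : d z x < r x := hzx
    have h2 : d z y < r y := hzy
    have hκ := hq.pos
    change d x y < 3 * κ * r y
    calc d x y ≤ κ * (d x z + d z y) := hq.triangle x y z
      _ < κ * (2 * r y + r y) := by
        rw [hq.symm x z]
        gcongr
        exact h1.trans_le hxy
      _ = 3 * κ * r y := by ring

/-- A weak form of the Lebesgue density theorem: a bounded set that has small relative measure in
arbitrarily small balls around each of its points is null. -/
theorem IsHomogeneousType.measure_eq_zero_of_small_density (h : IsHomogeneousType d μ κ C)
    {D s : ℝ≥0} (hD : ∀ (x : X) (r : ℝ), 0 < r →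
      μ (qball d x (3 * κ * r)) ≤ D * μ (qball d x r)) (hs : 2 * s * D ≤ 1)
    {N : Set X} {x₀ : X} {r₀ : ℝ} (hr₀ : 0 < r₀) (hN : N ⊆ qball d x₀ r₀)
    (hdens : ∀ x ∈ N, ∀ ε : ℝ, 0 < ε → ∃ ρ, 0 < ρ ∧ ρ < ε ∧
      μ (N ∩ qball d x ρ) ≤ s * μ (qball d x ρ)) : μ N = 0 := by
  have hq := h.quasiMetric
  have hκ := hq.pos
  obtain ⟨W, hWo, hBW, hWB⟩ := hq.exists_isOpen_between x₀ hr₀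
  have hμW : μ W ≠ ∞ := ne_top_of_le_ne_top (h.ball_lt_top x₀ _ (by positivity)).ne
    (measure_mono hWB)
  by_contra hN0
  have hNtop : μ N ≠ ∞ := ne_top_of_le_ne_top hμW (measure_mono (hN.trans hBW))
  obtain ⟨U, hNU, hUW, hUo, hμU⟩ := h.exists_isOpen_measure_lt hWo (hN.trans hBW) hμW
    (b := 2 * μ N) (by
      rw [two_mul]
      exact ENNReal.lt_add_right hNtop hN0)
  -- the small density is required of the dilate by `3κ`, which is what the covering produces
  have hchoice : ∀ x, ∃ ρ, x ∈ N → 0 < ρ ∧ ρ ≤ 1 ∧ qball d x ρ ⊆ U ∧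
      μ (N ∩ qball d x (3 * κ * ρ)) ≤ s * μ (qball d x (3 * κ * ρ)) := by
    intro x
    by_cases hx : x ∈ N
    · obtain ⟨ε, hε, hεU⟩ := hUo x (hNU hx)
      obtain ⟨ρ, hρ, hρε, hρN⟩ := hdens x hx (3 * κ * min ε 1) (by positivity)
      have h3 : ρ / (3 * κ) ≤ min ε 1 := by
        rw [div_le_iff₀ (by positivity)]
        linarith
      refine ⟨ρ / (3 * κ), fun _ => ⟨by positivity, h3.trans (min_le_right _ _),
        (qball_mono x (h3.trans (min_le_left _ _))).trans hεU, ?_⟩⟩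
      rwa [mul_div_cancel₀ _ (by positivity)]
    · exact ⟨0, fun hx' => absurd hx' hx⟩
  choose ρ hρ using hchoice
  have hμU' : μ U ≠ ∞ := ne_top_of_le_ne_top hμW (measure_mono hUW)
  obtain ⟨u, huN, huc, hdisj, hcov⟩ := h.exists_disjoint_covering (A := N) (W := U) (r := ρ)
    (R := (1 : ℝ)) (fun x hx => (hρ x hx).1) (fun x hx => (hρ x hx).2.1) (fun x hx => (hρ x hx).2.2.1)
    hμU'
  have := huc.to_subtype
  have hle : μ N ≤ s * D * μ U := calc
    μ N ≤ μ (⋃ x : u, N ∩ qball d x (3 * κ * ρ x)) := by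
        refine measure_mono fun x hx => ?_
        obtain ⟨y, hy, hxy⟩ := mem_iUnion₂.1 (hcov hx)
        exact mem_iUnion.2 ⟨⟨y, hy⟩, hx, hxy⟩
    _ ≤ ∑' x : u, μ (N ∩ qball d x (3 * κ * ρ x)) := measure_iUnion_le _
    _ ≤ ∑' x : u, s * D * μ (qball d x (ρ x)) := by
        refine ENNReal.tsum_le_tsum fun x => ((hρ x (huN x.2)).2.2.2).trans ?_
        exact (mul_le_mul_right (hD x _ (hρ x (huN x.2)).1) _).trans_eq (mul_assoc _ _ _).symm
    _ = s * D * ∑' x : u, μ (qball d x (ρ x)) := ENNReal.tsum_mul_left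
    _ ≤ s * D * μ U := by
        gcongr
        refine (tsum_meas_le_meas_iUnion_of_disjoint μ
          (As := fun x : u => qball d (x : X) (ρ x)) (fun x => h.measurableSet_ball x _ (hρ x (huN x.2)).1)
          (fun x y hxy => hdisj x.2 y.2 (Subtype.coe_injective.ne hxy))).trans ?_
        exact measure_mono (iUnion_subset fun x => (hρ x (huN x.2)).2.2.1)
  have hs' : (2 * s * D : ℝ≥0∞) ≤ 1 := by exact_mod_cast hs
  rcases eq_or_ne (s * D : ℝ≥0∞) 0 with h0 | h0
  · rw [h0, zero_mul] at hle
    exact hN0 (le_antisymm hle (zero_le))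
  · have : μ N < μ N := calc
      μ N ≤ s * D * μ U := hle
      _ < s * D * (2 * μ N) := by
          refine ENNReal.mul_lt_mul_right h0 ?_ hμU
          exact_mod_cast (ENNReal.coe_ne_top (r := s * D))
      _ = 2 * s * D * μ N := by ring
      _ ≤ 1 * μ N := by gcongr
      _ = μ N := one_mul _
    exact this.false

end Covering

/-! ### The John–Strömberg inequality -/

section JohnStromberg

variable {X : Type*} [MeasurableSpace X] {d : X → X → ℝ} {μ : Measure X} {κ : ℝ} {C : ℝ≥0}
  {f : X → ℝ} {c : X → ℝ → ℝ} {L : ℝ} {D s : ℝ≥0}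

/-- If `f` is within `L` of a constant on each of two nested comparable balls, up to a small
proportion of each, then the two constants differ by at most `2L`. -/
theorem IsHomogeneousType.abs_sub_le_of_qball_subset (h : IsHomogeneousType d μ κ C)
    (hD1 : 1 ≤ D) (hs : s * (4 * D ^ 2) ≤ 1)
    (hc : ∀ x r, 0 < r → μ {y ∈ qball d x r | L < |f y - c x r|} ≤ s * μ (qball d x r))
    {x x' : X} {r r' : ℝ} (hr : 0 < r) (hr' : 0 < r') (hsub : qball d x r ⊆ qball d x' r')
    (hμ : μ (qball d x' r') ≤ D * μ (qball d x r)) : |c x r - c x' r'| ≤ 2 * L := by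
  by_contra! hlt
  have hcover : qball d x r ⊆ {y ∈ qball d x r | L < |f y - c x r|} ∪
      {y ∈ qball d x' r' | L < |f y - c x' r'|} := by
    intro y hy
    by_contra hy'
    simp only [mem_union, mem_ofPred_eq, not_or, not_and, not_lt] at hy'
    have h1 := hy'.1 hy
    have h2 := hy'.2 (hsub hy)
    have h3 := abs_sub_le (c x r) (f y) (c x' r')
    rw [abs_sub_comm (c x r) (f y)] at h3
    linarith
  have h0 := (h.ball_pos x r hr).ne'
  have hsmall : s + s * D < 1 := by
    have h4 : s * 1 + s * D ≤ 2⁻¹ := by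
      rw [← NNReal.coe_le_coe] at hs hD1 ⊢
      push_cast at hs hD1 ⊢
      nlinarith [mul_nonneg s.coe_nonneg (sub_nonneg.2 hD1),
        mul_nonneg (mul_nonneg s.coe_nonneg D.coe_nonneg) (sub_nonneg.2 hD1)]
    rw [mul_one] at h4
    exact h4.trans_lt (inv_lt_one_of_one_lt₀ one_lt_two)
  have : μ (qball d x r) < μ (qball d x r) := calc
    μ (qball d x r) ≤ s * μ (qball d x r) + s * μ (qball d x' r') :=
      (measure_mono hcover).trans ((measure_union_le _ _).trans
        (add_le_add (hc x r hr) (hc x' r' hr')))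
    _ ≤ s * μ (qball d x r) + s * (D * μ (qball d x r)) := by gcongr
    _ = ((s + s * D : ℝ≥0) : ℝ≥0∞) * μ (qball d x r) := by push_cast; ring
    _ < 1 * μ (qball d x r) :=
      ENNReal.mul_lt_mul_left h0 (h.ball_lt_top x r hr).ne (by exact_mod_cast hsmall)
    _ = μ (qball d x r) := one_mul _
  exact this.false

/-- One step of the exponential decay: raising the level by `6L` halves the proportion of each ball
on which `f` deviates from its constant. The level set is covered, up to a null set, by the balls
at which the constants first leave `c x₀ r₀` by more than `4L`. -/
theorem IsHomogeneousType.measure_level_add_le (h : IsHomogeneousType d μ κ C)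
    (hf : Measurable f) (hD1 : 1 ≤ D) (hs : s * (4 * D ^ 2) ≤ 1)
    (hD : ∀ (x : X) (r t : ℝ), 0 < r → t ≤ 4 * κ ^ 2 * r →
      μ (qball d x t) ≤ D * μ (qball d x r)) (hL : 0 ≤ L)
    (hc : ∀ x r, 0 < r → μ {y ∈ qball d x r | L < |f y - c x r|} ≤ s * μ (qball d x r))
    {T : ℝ} (hT : 0 ≤ T) {q : ℝ≥0∞}
    (hq : ∀ x r, 0 < r → μ {y ∈ qball d x r | T < |f y - c x r|} ≤ q * μ (qball d x r))
    (x₀ : X) {r₀ : ℝ} (hr₀ : 0 < r₀) :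
    μ {y ∈ qball d x₀ r₀ | T + 6 * L < |f y - c x₀ r₀|} ≤ q * 2⁻¹ * μ (qball d x₀ r₀) := by
  have hqm := h.quasiMetric
  have hκ := hqm.pos
  have hκ1 := hqm.one_le
  have hκ2 : κ ≤ κ ^ 2 := by nlinarith
  have hcmp := fun {x x' : X} {r r' : ℝ} => h.abs_sub_le_of_qball_subset (x := x) (x' := x')
    (r := r) (r' := r') hD1 hs hc
  set c₀ := c x₀ r₀
  set B' := qball d x₀ (2 * κ * r₀)
  have hr' : 0 < 2 * κ * r₀ := by positivity
  have hB'D : μ B' ≤ D * μ (qball d x₀ r₀) := hD _ _ _ hr₀ (by nlinarith)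
  have hsubB' : ∀ x ∈ qball d x₀ r₀, ∀ r ≤ r₀, qball d x r ⊆ B' := fun x hx r hr =>
    hqm.qball_subset hx (by nlinarith)
  have hc' : |c₀ - c x₀ (2 * κ * r₀)| ≤ 2 * L :=
    hcmp hr₀ hr' (qball_mono _ (by nlinarith)) hB'D
  have hstart : ∀ x ∈ qball d x₀ r₀, |c x r₀ - c₀| ≤ 4 * L := by
    intro x hx
    have h1 : |c x r₀ - c x₀ (2 * κ * r₀)| ≤ 2 * L := by
      refine hcmp hr₀ hr' (hsubB' x hx _ le_rfl) ((measure_mono ?_).trans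
        (hD x r₀ (4 * κ ^ 2 * r₀) hr₀ le_rfl))
      have hx' : x₀ ∈ qball d x r₀ := (hqm.symm x₀ x).trans_lt hx
      exact hqm.qball_subset hx' (by nlinarith)
    have h2 := abs_sub_le (c x r₀) (c x₀ (2 * κ * r₀)) c₀
    rw [abs_sub_comm (c x₀ (2 * κ * r₀)) c₀] at h2
    linarith
  -- the points at which no ball of radius `r₀ / 2 ^ j` stops the selection
  let N := {x ∈ qball d x₀ r₀ | (∀ j : ℕ, |c x (r₀ / 2 ^ j) - c₀| ≤ 4 * L) ∧
    5 * L < |f x - c₀|}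
  let Ω := {x ∈ qball d x₀ r₀ | ∃ j : ℕ, 4 * L < |c x (r₀ / 2 ^ j) - c₀|}
  have hNnull : μ N = 0 := by
    refine h.measure_eq_zero_of_small_density (D := D) (s := s)
      (fun x r hr => hD x r _ hr (by nlinarith)) ?_ hr₀ (fun x hx => hx.1) ?_
    · rw [← NNReal.coe_le_coe] at hs hD1 ⊢
      push_cast at hs hD1 ⊢
      nlinarith [mul_nonneg (mul_nonneg s.coe_nonneg D.coe_nonneg) (sub_nonneg.2 hD1), mul_nonneg s.coe_nonneg D.coe_nonneg]
    · intro x hx ε hε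
      obtain ⟨j, hj⟩ := exists_pow_lt_of_lt_one (div_pos hε hr₀) (one_half_lt_one (α := ℝ))
      have hj' : r₀ / 2 ^ j < ε := by
        rw [lt_div_iff₀ hr₀] at hj
        calc r₀ / 2 ^ j = (1 / 2) ^ j * r₀ := by rw [one_div, inv_pow]; ring
          _ < ε := hj
      refine ⟨r₀ / 2 ^ j, by positivity, hj', (measure_mono ?_).trans (hc x _ (by positivity))⟩
      rintro y ⟨hyN, hy⟩
      refine ⟨hy, ?_⟩
      have h1 := hyN.2.2
      have h2 := hx.2.1 j
      have h3 := abs_sub_le (f y) (c x (r₀ / 2 ^ j)) c₀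
      linarith
  -- the first stopping index is positive by `hstart`, so the ball of twice the radius is not stopped
  have hchoice : ∀ x, ∃ r, x ∈ Ω → 0 < r ∧ r ≤ r₀ ∧ 4 * L < |c x r - c₀| ∧
      |c x (2 * r) - c₀| ≤ 4 * L := by
    classical
    intro x
    by_cases hx : x ∈ Ω
    · have hj := Nat.find_spec hx.2
      have hmin := fun i => Nat.find_min hx.2 (m := i)
      rcases hjj : Nat.find hx.2 with _ | i
      · rw [hjj, pow_zero, div_one] at hj
        exact absurd (hstart x hx.1) (not_le.2 hj)
      · rw [hjj] at hj hmin
        refine ⟨r₀ / 2 ^ (i + 1), fun _ => ⟨by positivity, ?_, hj, ?_⟩⟩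
        · exact div_le_self hr₀.le (one_le_pow₀ one_le_two)
        · have := not_lt.1 (hmin i (Nat.lt_succ_self i))
          rwa [pow_succ, show 2 * (r₀ / (2 ^ i * 2)) = r₀ / 2 ^ i by field_simp]
    · exact ⟨0, fun hx' => absurd hx' hx⟩
  choose r hr using hchoice
  obtain ⟨u, huΩ, huc, hdisj, hcov⟩ := h.exists_disjoint_covering (A := Ω) (W := B') (r := r)
    (fun x hx => (hr x hx).1) (fun x hx => (hr x hx).2.1)
    (fun x hx => hsubB' x hx.1 _ (hr x hx).2.1) (h.ball_lt_top x₀ _ hr').ne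
  have := huc.to_subtype
  let G := {y ∈ B' | L < |f y - c x₀ (2 * κ * r₀)|}
  have hGm : MeasurableSet G := (h.measurableSet_ball x₀ _ hr').inter
    (measurableSet_lt measurable_const (hf.sub_const _).abs)
  -- at least half of each selected ball lies in `G`
  have hhalf : ∀ x : u, μ (qball d x (r x)) ≤ 2 * μ (qball d (x : X) (r x) ∩ G) := by
    intro x
    obtain ⟨hr0, hrle, hfar, -⟩ := hr x (huΩ x.2)
    have hcover : qball d (x : X) (r x) ⊆
        {y ∈ qball d (x : X) (r x) | L < |f y - c x (r x)|} ∪ (qball d (x : X) (r x) ∩ G) := by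
      intro y hy
      by_cases hy' : L < |f y - c x (r x)|
      · exact Or.inl ⟨hy, hy'⟩
      · refine Or.inr ⟨hy, hsubB' x (huΩ x.2).1 _ hrle hy, ?_⟩
        have h1 := abs_sub_le (c x (r x)) (f y) c₀
        have h2 := abs_sub_le (f y) (c x₀ (2 * κ * r₀)) c₀
        rw [abs_sub_comm (c x (r x)) (f y)] at h1
        rw [abs_sub_comm (c x₀ (2 * κ * r₀)) c₀] at h2
        linarith
    have hs2 : (s : ℝ≥0∞) ≤ 2⁻¹ := by
      have : s ≤ 2⁻¹ := by
        rw [← NNReal.coe_le_coe] at hs hD1 ⊢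
        push_cast at hs hD1 ⊢
        nlinarith [mul_nonneg s.coe_nonneg (sub_nonneg.2 hD1),
          mul_nonneg (mul_nonneg s.coe_nonneg D.coe_nonneg) (sub_nonneg.2 hD1)]
      have h2 : ((2⁻¹ : ℝ≥0) : ℝ≥0∞) = 2⁻¹ := by simp
      rw [← h2]
      exact_mod_cast this
    have h1 : μ (qball d (x : X) (r x)) ≤
        2⁻¹ * μ (qball d (x : X) (r x)) + μ (qball d (x : X) (r x) ∩ G) :=
      (measure_mono hcover).trans ((measure_union_le _ _).trans
        (by gcongr; exact (hc x _ hr0).trans (by gcongr)))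
    have h2 : 2⁻¹ * μ (qball d (x : X) (r x)) + 2⁻¹ * μ (qball d (x : X) (r x)) ≤
        2⁻¹ * μ (qball d (x : X) (r x)) + μ (qball d (x : X) (r x) ∩ G) := by
      rwa [← add_mul, ENNReal.inv_two_add_inv_two, one_mul]
    have h3 := (ENNReal.add_le_add_iff_left (ENNReal.mul_ne_top (by simp)
      (h.ball_lt_top (x : X) _ hr0).ne)).1 h2
    calc μ (qball d (x : X) (r x)) = 2 * (2⁻¹ * μ (qball d (x : X) (r x))) := by
          rw [← mul_assoc, ENNReal.mul_inv_cancel two_ne_zero ENNReal.ofNat_ne_top, one_mul]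
      _ ≤ _ := by gcongr
  have hcover : {y ∈ qball d x₀ r₀ | T + 6 * L < |f y - c₀|} ⊆ N ∪ ⋃ x : u,
      {y ∈ qball d (x : X) (3 * κ * r x) | T < |f y - c x (3 * κ * r x)|} := by
    rintro y ⟨hy, hyT⟩
    by_cases hyΩ : y ∈ Ω
    · obtain ⟨x, hxu, hyx⟩ := mem_iUnion₂.1 (hcov hyΩ)
      refine Or.inr (mem_iUnion.2 ⟨⟨x, hxu⟩, hyx, ?_⟩)
      obtain ⟨hr0, hrle, -, hnear⟩ := hr x (huΩ hxu)
      have h1 : |c x (2 * r x) - c x (3 * κ * r x)| ≤ 2 * L :=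
        hcmp (by positivity) (by positivity) (qball_mono _ (by nlinarith))
          (hD x _ _ (by positivity) (by nlinarith))
      have h2 := abs_sub_le (f y) (c x (3 * κ * r x)) c₀
      have h3 := abs_sub_le (c x (3 * κ * r x)) (c x (2 * r x)) c₀
      rw [abs_sub_comm (c x (3 * κ * r x)) (c x (2 * r x))] at h3
      change T < |f y - c x (3 * κ * r x)|
      linarith
    · refine Or.inl ⟨hy, fun j => ?_, by linarith⟩
      by_contra! hj
      exact hyΩ ⟨hy, j, hj⟩
  have hsD : (2 * s * D ^ 2 : ℝ≥0∞) ≤ 2⁻¹ := by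
    have : 2 * s * D ^ 2 ≤ 2⁻¹ := by
      rw [← NNReal.coe_le_coe] at hs ⊢
      push_cast at hs ⊢
      linarith
    have h2 : ((2⁻¹ : ℝ≥0) : ℝ≥0∞) = 2⁻¹ := by simp
    rw [← h2]
    exact_mod_cast this
  calc μ {y ∈ qball d x₀ r₀ | T + 6 * L < |f y - c₀|}
      ≤ ∑' x : u, μ {y ∈ qball d (x : X) (3 * κ * r x) | T < |f y - c x (3 * κ * r x)|} := by
        refine (measure_mono hcover).trans ((measure_union_le _ _).trans ?_)
        rw [hNnull, zero_add]
        exact measure_iUnion_le _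
    _ ≤ ∑' x : u, q * D * 2 * μ (qball d (x : X) (r x) ∩ G) := by
        refine ENNReal.tsum_le_tsum fun x => ?_
        have hr0 := (hr x (huΩ x.2)).1
        calc μ {y ∈ qball d (x : X) (3 * κ * r x) | T < |f y - c x (3 * κ * r x)|}
            ≤ q * μ (qball d (x : X) (3 * κ * r x)) := hq x _ (by positivity)
          _ ≤ q * (D * (2 * μ (qball d (x : X) (r x) ∩ G))) :=
              mul_le_mul_right ((hD x _ _ hr0 (by nlinarith)).trans
                (mul_le_mul_right (hhalf x) _)) _
          _ = q * D * 2 * μ (qball d (x : X) (r x) ∩ G) := by ring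
    _ = q * D * 2 * ∑' x : u, μ (qball d (x : X) (r x) ∩ G) := ENNReal.tsum_mul_left
    _ ≤ q * D * 2 * μ G := by
        refine mul_le_mul_right ((tsum_meas_le_meas_iUnion_of_disjoint μ
          (As := fun x : u => qball d (x : X) (r x) ∩ G)
          (fun x => (h.measurableSet_ball x _ (hr x (huΩ x.2)).1).inter hGm)
          (fun x y hxy => (hdisj x.2 y.2 (Subtype.coe_injective.ne hxy)).mono
            inter_subset_left inter_subset_left)).trans ?_) _
        exact measure_mono (iUnion_subset fun x => inter_subset_right)
    _ ≤ q * D * 2 * (s * (D * μ (qball d x₀ r₀))) := by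
        refine mul_le_mul_right ((hc x₀ _ hr').trans ?_) _
        gcongr
    _ = q * (2 * s * D ^ 2) * μ (qball d x₀ r₀) := by ring
    _ ≤ q * 2⁻¹ * μ (qball d x₀ r₀) := by gcongr

/-- A layer-cake bound: `|t| / l` is at most the number of `k : ℕ` with `k * l < |t|`. -/
theorem coe_nnnorm_le_tsum_indicator (t : ℝ) {l : ℝ≥0} (hl : 0 < l) :
    (‖t‖₊ : ℝ≥0∞) ≤ ∑' k : ℕ, (Ioi ((k : ℝ) * l)).indicator (fun _ => (l : ℝ≥0∞)) |t| := by
  set n := ⌈|t| / l⌉₊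
  have hl' : (0 : ℝ) < l := hl
  have h1 : |t| ≤ n * l := (div_le_iff₀ hl').1 (Nat.le_ceil _)
  calc (‖t‖₊ : ℝ≥0∞) ≤ ((n * l : ℝ≥0) : ℝ≥0∞) := by
        rw [ENNReal.coe_le_coe, ← NNReal.coe_le_coe]
        push_cast
        exact h1
    _ = ∑ k ∈ Finset.range n, (l : ℝ≥0∞) := by simp
    _ = ∑ k ∈ Finset.range n, (Ioi ((k : ℝ) * l)).indicator (fun _ => (l : ℝ≥0∞)) |t| := by
        refine Finset.sum_congr rfl fun k hk => ?_
        rw [indicator_of_mem]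
        exact (lt_div_iff₀ hl').1 (Nat.lt_ceil.1 (Finset.mem_range.1 hk))
    _ ≤ _ := ENNReal.sum_le_tsum _

/-- A function that is, on each ball, within `L` of a constant outside a small proportion of that
ball has mean oscillation at most `12L`. -/
theorem IsHomogeneousType.bmoNorm_le (h : IsHomogeneousType d μ κ C)
    (hf : Measurable f) (hD1 : 1 ≤ D) (hs : s * (4 * D ^ 2) ≤ 1)
    (hD : ∀ (x : X) (r t : ℝ), 0 < r → t ≤ 4 * κ ^ 2 * r →
      μ (qball d x t) ≤ D * μ (qball d x r)) {L : ℝ≥0} (hL : 0 < L)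
    (hc : ∀ x r, 0 < r → μ {y ∈ qball d x r | (L : ℝ) < |f y - c x r|} ≤ s * μ (qball d x r)) :
    bmoNorm d μ f ≤ 12 * L := by
  have hdecay : ∀ (k : ℕ) (x : X) (r : ℝ), 0 < r →
      μ {y ∈ qball d x r | (k : ℝ) * (6 * L : ℝ≥0) < |f y - c x r|} ≤
        2⁻¹ ^ k * μ (qball d x r) := by
    intro k
    induction k with
    | zero =>
      intro x r _
      rw [pow_zero, one_mul]
      exact measure_mono fun y hy => hy.1
    | succ k ih =>
      intro x r hr
      have := h.measure_level_add_le hf hD1 hs hD L.coe_nonneg hc (by positivity) ih x hr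
      rw [← pow_succ] at this
      convert this using 6
      push_cast
      ring
  refine iSup_le fun x => iSup_le fun r => iSup_le fun hr => iInf_le_of_le (c x r) ?_
  have hB := h.measurableSet_ball x r hr
  rw [setLAverage_eq]
  refine ENNReal.div_le_of_le_mul ?_
  have hm : ∀ k : ℕ, MeasurableSet {y | (k : ℝ) * (6 * L : ℝ≥0) < |f y - c x r|} := fun k =>
    measurableSet_lt measurable_const (hf.sub_const _).abs
  calc ∫⁻ y in qball d x r, (‖f y - c x r‖₊ : ℝ≥0∞) ∂μ
      ≤ ∫⁻ y in qball d x r, ∑' k : ℕ, {y | (k : ℝ) * (6 * L : ℝ≥0) < |f y - c x r|}.indicator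
          (fun _ => ((6 * L : ℝ≥0) : ℝ≥0∞)) y ∂μ :=
        lintegral_mono fun y => coe_nnnorm_le_tsum_indicator (f y - c x r) (by positivity)
    _ = ∑' k : ℕ, ((6 * L : ℝ≥0) : ℝ≥0∞) *
          μ {y ∈ qball d x r | (k : ℝ) * (6 * L : ℝ≥0) < |f y - c x r|} := by
        rw [lintegral_tsum fun k => (measurable_const.indicator (hm k)).aemeasurable]
        refine tsum_congr fun k => ?_
        rw [lintegral_indicator_const (hm k), Measure.restrict_apply (hm k), inter_comm]
        rfl
    _ ≤ ∑' k : ℕ, ((6 * L : ℝ≥0) : ℝ≥0∞) * (2⁻¹ ^ k * μ (qball d x r)) :=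
        ENNReal.tsum_le_tsum fun k => mul_le_mul_right (hdecay k x r hr) _
    _ = 12 * L * μ (qball d x r) := by
        rw [ENNReal.tsum_mul_left, ENNReal.tsum_mul_right, ENNReal.tsum_geometric,
          ENNReal.one_sub_inv_two, inv_inv]
        push_cast
        ring

end JohnStromberg

/-! ### Concave functions and the Luxemburg expression -/

theorem exists_eq_one {φ : ℝ≥0 → ℝ≥0} (hcont : Continuous φ) (hzero : φ 0 = 0)
    (hlim : Tendsto φ atTop atTop) : ∃ a, φ a = 1 := by
  obtain ⟨t, ht⟩ := (hlim.eventually_ge_atTop 1).exists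
  exact mem_range_of_exists_le_of_exists_ge hcont ⟨0, by simp [hzero]⟩ ⟨t, ht⟩

/-- A concave increasing function on `[0, ∞)` has a supporting line at each `a > 0`; its slope and
its intercept are nonnegative. -/
theorem exists_supporting_line {φ : ℝ≥0 → ℝ≥0} (hmono : Monotone φ)
    (hconc : ConcaveOn ℝ≥0 univ φ) {a : ℝ≥0} (ha : 0 < a) :
    ∃ b k : ℝ≥0, b + k * a = φ a ∧ ∀ t, φ t ≤ b + k * t := by
  let ψ : ℝ → ℝ := fun t => φ t.toNNReal
  have hψ : ConcaveOn ℝ (Ici 0) ψ := by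
    refine ⟨convex_Ici 0, fun x hx y hy p q hp hq hpq => ?_⟩
    have := hconc.2 (mem_univ x.toNNReal) (mem_univ y.toNNReal) (zero_le (a := p.toNNReal))
      (zero_le (a := q.toNNReal)) (by rw [← Real.toNNReal_add hp hq, hpq, Real.toNNReal_one])
    have h2 : (p • x + q • y).toNNReal = p.toNNReal • x.toNNReal + q.toNNReal • y.toNNReal := by
      simp only [smul_eq_mul]
      rw [Real.toNNReal_add (mul_nonneg hp hx) (mul_nonneg hq hy), Real.toNNReal_mul hp,
        Real.toNNReal_mul hq]
    rw [← h2, ← NNReal.coe_le_coe] at this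
    simpa [ψ, hp, hq] using this
  have hslope : ∀ s t : ℝ≥0, s < a → a < t →
      ((φ t : ℝ) - φ a) / (t - a) ≤ ((φ a : ℝ) - φ s) / (a - s) := fun s t hs ht => by
    simpa [ψ] using hψ.slope_anti_adjacent (x := (s : ℝ)) (y := a) (z := t) s.2 t.2
      (by exact_mod_cast hs) (by exact_mod_cast ht)
  let S : Set ℝ := (fun t : ℝ≥0 => ((φ t : ℝ) - φ a) / (t - a)) '' Ioi a
  have hSb : ∀ s < a, ∀ m ∈ S, m ≤ ((φ a : ℝ) - φ s) / (a - s) := by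
    rintro s hs _ ⟨t, ht, rfl⟩
    exact hslope s t hs ht
  have hne : S.Nonempty := ⟨_, a + 1, by simp, rfl⟩
  have hk0 : 0 ≤ sSup S := by
    refine Real.sSup_nonneg ?_
    rintro _ ⟨t, ht, rfl⟩
    have h1 : (a : ℝ) ≤ t := by exact_mod_cast (mem_Ioi.1 ht).le
    have h2 : (φ a : ℝ) ≤ φ t := by exact_mod_cast hmono (mem_Ioi.1 ht).le
    exact div_nonneg (sub_nonneg.2 h2) (sub_nonneg.2 h1)
  have hline : ∀ t : ℝ≥0, (φ t : ℝ) ≤ φ a + sSup S * (t - a) := by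
    intro t
    rcases lt_trichotomy t a with ht | rfl | ht
    · have h1 := csSup_le hne (hSb t ht)
      have h2 : (0 : ℝ) < a - t := sub_pos.2 (by exact_mod_cast ht)
      rw [le_div_iff₀ h2] at h1
      linarith
    · simp
    · have h1 := le_csSup ⟨_, hSb 0 ha⟩ (mem_image_of_mem _ ht)
      have h2 : (0 : ℝ) < t - a := sub_pos.2 (by exact_mod_cast ht)
      rw [div_le_iff₀ h2] at h1
      linarith
  have hb : (0 : ℝ) ≤ φ a - sSup S * a := by
    have h1 := hline 0
    have h2 := (φ 0).2
    simp only [NNReal.val_eq_coe, NNReal.coe_zero] at h1 h2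
    linarith
  obtain ⟨k, hk⟩ : ∃ k : ℝ≥0, (k : ℝ) = sSup S := ⟨⟨_, hk0⟩, rfl⟩
  obtain ⟨b, hb'⟩ : ∃ b : ℝ≥0, (b : ℝ) = φ a - sSup S * a := ⟨⟨_, hb⟩, rfl⟩
  refine ⟨b, k, ?_, fun t => ?_⟩
  · rw [← NNReal.coe_inj]
    push_cast
    linarith [congrArg (· * (a : ℝ)) hk]
  · rw [← NNReal.coe_le_coe]
    push_cast
    rw [hk, hb']
    linarith [hline t]

section Luxemburg

variable {X : Type*} [MeasurableSpace X] {μ : Measure X} {B : Set X} {φ : ℝ≥0 → ℝ≥0}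

/-- Jensen's inequality for the Luxemburg expression, obtained by integrating the supporting line
of `φ` at `a`. -/
theorem mul_luxemburg_le_laverage (hmono : Monotone φ) (hconc : ConcaveOn ℝ≥0 univ φ)
    {a : ℝ≥0} (ha : 0 < a) (hφa : φ a = 1) (hB0 : μ B ≠ 0) (hB : μ B ≠ ∞) {g : X → ℝ} :
    a * luxemburg φ μ B g ≤ ⨍⁻ x in B, (‖g x‖₊ : ℝ≥0∞) ∂μ := by
  obtain ⟨b, k, hbk, hline⟩ := exists_supporting_line hmono hconc ha
  have hprob : IsProbabilityMeasure ((μ B)⁻¹ • μ.restrict B) := ⟨by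
    simp [ENNReal.inv_mul_cancel hB0 hB]⟩
  set ν := (μ B)⁻¹ • μ.restrict B
  have havg : ∀ F : X → ℝ≥0∞, ⨍⁻ x in B, F x ∂μ = ∫⁻ x, F x ∂ν := fun F => by
    rw [laverage_eq', Measure.restrict_apply_univ]
  rw [havg]
  refine ENNReal.le_of_forall_pos_le_add fun ε hε hfin => ?_
  obtain ⟨m, hm⟩ := WithTop.ne_top_iff_exists.1 hfin.ne
  change (m : ℝ≥0∞) = _ at hm
  rw [← hm]
  -- the choice of `lam` for which `lam * a` slightly exceeds the mean of `|g|`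
  have hlam : 0 < (m + ε) / a := by positivity
  calc (a : ℝ≥0∞) * luxemburg φ μ B g ≤ a * (((m + ε) / a : ℝ≥0) : ℝ≥0∞) := by
        gcongr
        refine iInf_le_of_le _ (iInf_le_of_le hlam (iInf_le_of_le ?_ le_rfl))
        rw [havg]
        calc ∫⁻ x, (φ (‖g x‖₊ / ((m + ε) / a)) : ℝ≥0∞) ∂ν
            ≤ ∫⁻ x, ((b : ℝ≥0∞) + (k / ((m + ε) / a) : ℝ≥0) * ‖g x‖₊) ∂ν := by
              refine lintegral_mono fun x => ?_
              have h1 := hline (‖g x‖₊ / ((m + ε) / a))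
              rw [mul_div_assoc', ← div_mul_eq_mul_div] at h1
              rw [← ENNReal.coe_mul, ← ENNReal.coe_add]
              exact ENNReal.coe_le_coe.2 h1
          _ = b + (k / ((m + ε) / a) : ℝ≥0) * m := by
              rw [lintegral_add_left measurable_const,
                lintegral_const_mul' _ _ ENNReal.coe_ne_top, ← hm]
              simp
          _ ≤ 1 := by
              have : b + k / ((m + ε) / a) * m ≤ 1 := calc
                b + k / ((m + ε) / a) * m ≤ b + k / ((m + ε) / a) * (m + ε) := by
                  gcongr
                  exact le_self_add
                _ = b + k * a := by
                  have : m + ε ≠ 0 := by positivity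
                  field_simp
                _ = 1 := hbk.trans hφa
              exact_mod_cast this
    _ = ((m + ε : ℝ≥0) : ℝ≥0∞) := by
        rw [← ENNReal.coe_mul, mul_div_cancel₀ _ ha.ne']
    _ = m + ε := by push_cast; rfl

/-- Chebyshev's inequality for the Luxemburg expression. -/
theorem measure_lt_of_luxemburg_lt (hmono : Monotone φ) (hB : MeasurableSet B) (hB0 : μ B ≠ 0)
    (hBt : μ B ≠ ∞) {g : X → ℝ} (hg : Measurable g) {lam s t : ℝ≥0}
    (hlux : luxemburg φ μ B g < lam) (hst : 1 ≤ s * φ t) :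
    μ {x ∈ B | (t * lam : ℝ) < |g x|} ≤ s * μ B := by
  simp only [luxemburg, iInf_lt_iff] at hlux
  obtain ⟨l, hl, hmean, hll⟩ := hlux
  have hll' : l < lam := by exact_mod_cast hll
  rw [setLAverage_eq, ENNReal.div_le_iff hB0 hBt, one_mul] at hmean
  set S := {x ∈ B | (t * lam : ℝ) < |g x|}
  have hSm : MeasurableSet S := hB.inter (measurableSet_lt measurable_const hg.abs)
  calc μ S ≤ s * φ t * μ S := by
        have : (1 : ℝ≥0∞) ≤ s * φ t := by exact_mod_cast hst
        calc μ S = 1 * μ S := (one_mul _).symm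
          _ ≤ _ := by gcongr
    _ = s * ∫⁻ _ in S, (φ t : ℝ≥0∞) ∂μ := by rw [setLIntegral_const, mul_assoc]
    _ ≤ s * ∫⁻ x in S, (φ (‖g x‖₊ / l) : ℝ≥0∞) ∂μ := by
        refine mul_le_mul_right (setLIntegral_mono' hSm fun x hx => ?_) _
        have h1 : t ≤ ‖g x‖₊ / l := by
          rw [le_div_iff₀ hl, ← NNReal.coe_le_coe]
          push_cast
          refine le_trans ?_ hx.2.le
          gcongr
        exact_mod_cast hmono h1
    _ ≤ s * ∫⁻ x in B, (φ (‖g x‖₊ / l) : ℝ≥0∞) ∂μ := by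
        gcongr
        exact fun x hx => hx.1
    _ ≤ s * μ B := by gcongr

end Luxemburg

/-! ### Comparison of the two norms -/

section Comparison

variable {X : Type*} [MeasurableSpace X] {d : X → X → ℝ} {μ : Measure X} {κ : ℝ} {C : ℝ≥0}
  {φ : ℝ≥0 → ℝ≥0}

theorem IsHomogeneousType.mul_bmoPhiNorm_le_bmoNorm (h : IsHomogeneousType d μ κ C)
    (hmono : Monotone φ) (hconc : ConcaveOn ℝ≥0 univ φ) {a : ℝ≥0} (ha : 0 < a) (hφa : φ a = 1)
    (f : X → ℝ) : a * bmoPhiNorm φ d μ f ≤ bmoNorm d μ f := by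
  simp only [bmoPhiNorm, bmoNorm, ENNReal.mul_iSup]
  refine iSup_mono fun x => iSup_mono fun r => iSup_mono fun hr => le_iInf fun c => ?_
  refine (mul_le_mul_right (iInf_le _ c) _).trans ?_
  exact mul_luxemburg_le_laverage hmono hconc ha hφa (h.ball_pos x r hr).ne'
    (h.ball_lt_top x r hr).ne

/-- The constant is `12t`, where `φ t` exceeds the reciprocal of the proportion that the
John–Strömberg argument tolerates. -/
theorem IsHomogeneousType.bmoNorm_le_mul_bmoPhiNorm (h : IsHomogeneousType d μ κ C)
    (hmono : Monotone φ) {n : ℕ} (hn : 4 * κ ^ 2 ≤ 2 ^ n) {t : ℝ≥0} (ht : 0 < t)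
    (hφt : 4 * ((C + 1) ^ n) ^ 2 ≤ φ t) {f : X → ℝ} (hf : Measurable f) :
    bmoNorm d μ f ≤ (12 * t : ℝ≥0) * bmoPhiNorm φ d μ f := by
  set D : ℝ≥0 := (C + 1) ^ n with hDdef
  have hD1 : 1 ≤ D := one_le_pow₀ le_add_self
  have hD0 : 0 < D := one_pos.trans_le hD1
  have hD : ∀ (x : X) (r t : ℝ), 0 < r → t ≤ 4 * κ ^ 2 * r →
      μ (qball d x t) ≤ D * μ (qball d x r) := fun x r t hr htr => by
    refine (h.measure_qball_le n x hr (htr.trans (by gcongr))).trans ?_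
    rw [hDdef]
    push_cast
    gcongr
    exact le_self_add
  set s : ℝ≥0 := (4 * D ^ 2)⁻¹ with hsdef
  have hs : s * (4 * D ^ 2) = 1 := inv_mul_cancel₀ (by positivity)
  have hst : 1 ≤ s * φ t := hs.symm.le.trans (by gcongr)
  rcases eq_or_ne (bmoPhiNorm φ d μ f) ∞ with htop | htop
  · rw [htop, ENNReal.mul_top (by positivity)]
    exact le_top
  have key : ∀ lam : ℝ≥0, bmoPhiNorm φ d μ f < lam →
      bmoNorm d μ f ≤ (12 * t : ℝ≥0) * lam := by
    intro lam hlam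
    have hlam0 : 0 < lam := by exact_mod_cast (zero_le).trans_lt hlam
    have hchoice : ∀ x r, ∃ c : ℝ, 0 < r →
        luxemburg φ μ (qball d x r) (fun y => f y - c) < lam := by
      intro x r
      by_cases hr : 0 < r
      · have h1 : ⨅ c : ℝ, luxemburg φ μ (qball d x r) (fun y => f y - c) < lam :=
          lt_of_le_of_lt (le_iSup_of_le x (le_iSup_of_le r
            (le_iSup (fun _ : 0 < r => ⨅ c : ℝ, luxemburg φ μ (qball d x r) fun y => f y - c) hr))) hlam
        obtain ⟨c, hc⟩ := iInf_lt_iff.1 h1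
        exact ⟨c, fun _ => hc⟩
      · exact ⟨0, fun hr' => absurd hr' hr⟩
    choose c hc using hchoice
    have := h.bmoNorm_le hf hD1 hs.le hD (mul_pos ht hlam0) (c := c) fun x r hr => by
      simpa using measure_lt_of_luxemburg_lt hmono (h.measurableSet_ball x r hr)
        (h.ball_pos x r hr).ne' (h.ball_lt_top x r hr).ne (hf.sub_const _) (hc x r hr) hst
    refine this.trans_eq ?_
    push_cast
    ring
  refine ENNReal.le_of_forall_pos_le_add fun ε hε _ => ?_
  lift bmoPhiNorm φ d μ f to ℝ≥0 using htop with b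
  have hlt : b < b + ε / (12 * t) := lt_add_of_pos_right _ (by positivity)
  refine (key _ (by exact_mod_cast hlt)).trans_eq ?_
  rw [← ENNReal.coe_mul, ← ENNReal.coe_mul, ← ENNReal.coe_add, mul_add,
    mul_div_cancel₀ _ (by positivity)]

end Comparison

end HomogeneousType

theorem theorem1p3 (φ : ℝ≥0 → ℝ≥0) (hφ_mono : Monotone φ) (hφ_conc : ConcaveOn ℝ≥0 univ φ)
    (hφ_cont : Continuous φ) (hφ_zero : φ 0 = 0) (hφ_lim : Tendsto φ atTop atTop)
    (κ : ℝ) (C : ℝ≥0) :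
    ∃ c : ℝ≥0, ∀ (X : Type*) [MeasurableSpace X] (d : X → X → ℝ) (μ : Measure X),
      HomogeneousType.IsHomogeneousType d μ κ C →
        HomogeneousType.BMO d μ = HomogeneousType.BMOPhi φ d μ ∧
        ∀ f : X → ℝ, Measurable f →
          ((Function.invFun φ 1 : ℝ≥0) : ℝ≥0∞) * HomogeneousType.bmoPhiNorm φ d μ f
              ≤ HomogeneousType.bmoNorm d μ f ∧
          HomogeneousType.bmoNorm d μ f ≤ c * HomogeneousType.bmoPhiNorm φ d μ f := by
  have ha : φ (Function.invFun φ 1) = 1 :=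
    Function.invFun_eq (HomogeneousType.exists_eq_one hφ_cont hφ_zero hφ_lim)
  set a := Function.invFun φ 1
  have ha0 : 0 < a := by
    rw [pos_iff_ne_zero]
    intro h0
    rw [h0, hφ_zero] at ha
    exact zero_ne_one ha
  obtain ⟨n, hn⟩ := pow_unbounded_of_one_lt (4 * κ ^ 2) (one_lt_two (α := ℝ))
  obtain ⟨t, hφt, ht⟩ := ((hφ_lim.eventually_ge_atTop (4 * ((C + 1) ^ n) ^ 2)).and
    (eventually_gt_atTop 0)).exists
  refine ⟨12 * t, fun X _ d μ h => ?_⟩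
  have hlower := h.mul_bmoPhiNorm_le_bmoNorm hφ_mono hφ_conc ha0 ha
  have hupper := fun (f : X → ℝ) (hf : Measurable f) =>
    h.bmoNorm_le_mul_bmoPhiNorm hφ_mono hn.le ht hφt hf
  refine ⟨?_, fun f hf => ⟨hlower f, hupper f hf⟩⟩
  ext f
  refine and_congr_right fun hf => ⟨fun hfin => ?_, fun hfin => ?_⟩
  · by_contra htop
    rw [not_lt, top_le_iff] at htop
    have h1 := hlower f
    rw [htop, ENNReal.mul_top (by exact_mod_cast ha0.ne'), top_le_iff] at h1
    exact hfin.ne h1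
  · exact (hupper f hf).trans_lt (ENNReal.mul_lt_top ENNReal.coe_lt_top hfin)
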